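/- Let $(X_n)_{n\ge 0}$ be a Markov chain on a finite state space $S=\{1,\dots,m\}$ with irreducible transition matrix $P$. Let $\boldsymbol\pi$ be its stationary probability vector, so that $\boldsymbol\pi^T P=\boldsymbol\pi^T$ and $\boldsymbol\pi^T\mathbf e=1$, where $\mathbf e=(1,\dots,1)^T$. For $i,j\in S$ let $T_{ij}=\min\{n\ge 1: X_n=j\}$ for the chain started at $X_0=i$, and put $M=[m_{ij}]$, $M^{(2)}=[m^{(2)}_{ij}]$ with $m_{ij}=E[T_{ij}\mid X_0=i]$ and $m^{(2)}_{ij}=E[T_{ij}^2\mid X_0=i]$. Write $E=\mathbf e\mathbf e^T$, $\Pi=\mathbf e\boldsymbol\pi^T$ and, for a square matrix $A$, $A_d$ for the diagonal matrix with the same diagonal entries as $A$. Then all $m_{ij}$ and $m_{ij}^{(2)}$ are finite, all $\pi_i$ are positive, and $M_d=D$, where $D$ is the diagonal matrix with diagonal entries $1/\pi_i$. Moreover, for any g-inverse $G$ of $I-P$, i.e. any real matrix $G$ with $(I-P)G(I-P)=I-P$, $$M^{(2)}=2[GM-E(GM)_d]+[I-G+EG_d]\,[M^{(2)}_d+D]-M$$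 and $$M^{(2)}=2[GM-E(GM)_d]+2[I-G+EG_d]\,D\,(\Pi M)_d-M.$$ If in addition $G\mathbf e=g\mathbf e$ for some real constant $g$, then $$M^{(2)}=2[GM-E(GM)_d]+MD^{-1}M^{(2)}_d.$$ -/

import Mathlib

open MeasureTheory Matrix
open scoped ENNReal

namespace MarkovFPT

/-- `X` is a time-homogeneous Markov chain on the finite state space `S` with transition matrix
`P`; `ℙ i` is the law on `Ω` under which the chain is started at `i`, i.e. the conditional
probability given `X 0 = i`. The last field is the Markov property
`ℙ i (X (n+1) = a (n+1) | X 0 = a 0, …, X n = a n) = P (a n) (a (n+1))`, multiplied out so that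
conditioning events of probability zero need no convention. -/
structure IsMarkovChain {S Ω : Type*} [MeasurableSpace Ω] (P : Matrix S S ℝ)
    (ℙ : S → Measure Ω) (X : ℕ → Ω → S) : Prop where
  isProbabilityMeasure : ∀ i, IsProbabilityMeasure (ℙ i)
  measurableSet_eq : ∀ n s, MeasurableSet {ω | X n ω = s}
  start : ∀ i, ∀ᵐ ω ∂(ℙ i), X 0 ω = i
  markov : ∀ (i : S) (n : ℕ) (a : ℕ → S),
    ℙ i {ω | ∀ k ≤ n + 1, X k ω = a k} =
      ℙ i {ω | ∀ k ≤ n, X k ω = a k} * ENNReal.ofReal (P (a n) (a (n + 1)))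

/-- The first passage time `min {n ≥ 1 : X n = j}`, with value `⊤` if `j` is never visited at a
time `n ≥ 1`. -/
noncomputable def passageTime {S Ω : Type*} (X : ℕ → Ω → S) (j : S) (ω : Ω) : ℕ∞ :=
  hittingAfter X {j} 1 ω

/-- The `k`-th moment `E[T_{ij} ^ k | X 0 = i]` of the first passage time from `i` to `j`, as an
extended nonnegative number. -/
noncomputable def passageMoment {S Ω : Type*} [MeasurableSpace Ω] (ℙ : S → Measure Ω)
    (X : ℕ → Ω → S) (k : ℕ) (i j : S) : ℝ≥0∞ :=
  ∫⁻ ω, (passageTime X j ω : ℝ≥0∞) ^ k ∂(ℙ i)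

/-- The real matrix of `k`-th moments of the first passage times. -/
noncomputable def momentMatrix {S Ω : Type*} [MeasurableSpace Ω] (ℙ : S → Measure Ω)
    (X : ℕ → Ω → S) (k : ℕ) : Matrix S S ℝ :=
  Matrix.of fun i j => (passageMoment ℙ X k i j).toReal

/-- `G` is a (one-condition) generalized inverse of `A`. -/
def IsGInverse {S : Type*} [Fintype S] (A G : Matrix S S ℝ) : Prop :=
  A * G * A = A

/-- The diagonal matrix `A_d` with the same diagonal entries as `A`. -/
def diagPart {S : Type*} [DecidableEq S] (A : Matrix S S ℝ) : Matrix S S ℝ :=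
  Matrix.diagonal A.diag

end MarkovFPT

/-! Removing the transitions into `j` from `P` gives a substochastic matrix whose powers carry the
law of the path before it hits `j`, so the tails of `T_ij` are the row sums `survival`.
Irreducibility makes these decay geometrically; hence both moments are finite and equal to tail
sums, and one-step recursion of the tails gives `(I-P)M = E - P M_d` and `(I-P)M2 = (2M-E) - P
M2_d`. Both have the form `(I-P)Y = R - P Y_d`. Harmonic functions are constant, so `G` solves this
up to a constant in each column, and the diagonal entries fix that constant
(`IsGInverse.eq_of_one_sub_mul_eq`). Multiplying by `π` on the left gives the diagonals themselves.
The three formulas follow by combining the two solutions. -/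

namespace MarkovFPT

/-! ### Taboo matrices, geometric decay of survival probabilities, harmonic functions -/

section Taboo

variable {S : Type*} [DecidableEq S]

/-- The transition matrix `P` with the transitions into `j` removed. -/
def taboo (P : Matrix S S ℝ) (j : S) : Matrix S S ℝ :=
  Matrix.of fun i k => if k = j then 0 else P i k

lemma taboo_apply (P : Matrix S S ℝ) (j i k : S) :
    taboo P j i k = if k = j then 0 else P i k := rfl

lemma taboo_nonneg {P : Matrix S S ℝ} (hP : ∀ i k, 0 ≤ P i k) (j i k : S) :
    0 ≤ taboo P j i k := by
  rw [taboo_apply]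
  split_ifs
  · exact le_rfl
  · exact hP i k

variable [Fintype S]

/-- The probability that the chain with transition matrix `P` started at `i` avoids `j` at the
times `1, …, n`. -/
def survival (P : Matrix S S ℝ) (j : S) (n : ℕ) (i : S) : ℝ :=
  ((taboo P j) ^ n *ᵥ 1) i

lemma taboo_pow_nonneg {P : Matrix S S ℝ} (hP : ∀ i k, 0 ≤ P i k) (j : S) (n : ℕ) (i k : S) :
    0 ≤ (taboo P j ^ n) i k := by
  induction n generalizing i k with
  | zero => rw [pow_zero, one_apply]; split_ifs <;> simp
  | succ n ih =>
    rw [pow_succ, mul_apply]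
    exact Finset.sum_nonneg fun l _ => mul_nonneg (ih i l) (taboo_nonneg hP j l k)

lemma survival_eq_sum (P : Matrix S S ℝ) (j : S) (n : ℕ) (i : S) :
    survival P j n i = ∑ k, (taboo P j ^ n) i k := by
  simp [survival, mulVec, dotProduct]

lemma survival_zero (P : Matrix S S ℝ) (j i : S) : survival P j 0 i = 1 := by
  simp [survival]

lemma survival_succ (P : Matrix S S ℝ) (j : S) (n : ℕ) (i : S) :
    survival P j (n + 1) i = ∑ k, taboo P j i k * survival P j n k := by
  rw [survival, pow_succ', ← mulVec_mulVec]
  rfl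

lemma survival_nonneg {P : Matrix S S ℝ} (hP : ∀ i k, 0 ≤ P i k) (j : S) (n : ℕ) (i : S) :
    0 ≤ survival P j n i := by
  rw [survival_eq_sum]
  exact Finset.sum_nonneg fun k _ => taboo_pow_nonneg hP j n i k

lemma survival_succ_le {P : Matrix S S ℝ} (hP : P ∈ rowStochastic ℝ S) (j : S) (n : ℕ) (i : S) :
    survival P j (n + 1) i ≤ survival P j n i := by
  have h0 := (mem_rowStochastic_iff_sum.1 hP).1
  induction n generalizing i with
  | zero =>
    rw [survival_succ, survival_zero, ← (mem_rowStochastic_iff_sum.1 hP).2 i]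
    refine Finset.sum_le_sum fun k _ => ?_
    rw [survival_zero, mul_one, taboo_apply]
    split_ifs
    · exact h0 i k
    · exact le_rfl
  | succ n ih =>
    rw [survival_succ, survival_succ P j n]
    exact Finset.sum_le_sum fun k _ => mul_le_mul_of_nonneg_left (ih k) (taboo_nonneg h0 j i k)

lemma survival_antitone {P : Matrix S S ℝ} (hP : P ∈ rowStochastic ℝ S) (j i : S) :
    Antitone fun n => survival P j n i :=
  antitone_nat_of_succ_le fun n => survival_succ_le hP j n i

lemma survival_le_one {P : Matrix S S ℝ} (hP : P ∈ rowStochastic ℝ S) (j : S) (n : ℕ) (i : S) :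
    survival P j n i ≤ 1 :=
  survival_zero P j i ▸ survival_antitone hP j i (Nat.zero_le n)

/-- Avoiding `j` up to time `n + 1` and sitting at `j` at time `n + 1` are disjoint events. Thus a
positive entry of a power of `P` forces survival strictly below one. -/
lemma survival_add_pow_le_one {P : Matrix S S ℝ} (hP : P ∈ rowStochastic ℝ S) (j : S) (n : ℕ)
    (i : S) : survival P j (n + 1) i + (P ^ (n + 1)) i j ≤ 1 := by
  obtain ⟨h0, h1⟩ := mem_rowStochastic_iff_sum.1 hP
  induction n generalizing i with
  | zero =>
    rw [survival_succ, zero_add, pow_one, ← h1 i, ← Finset.add_sum_erase _ _ (Finset.mem_univ j),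
      ← Finset.add_sum_erase _ (P i) (Finset.mem_univ j)]
    have : ∑ x ∈ Finset.univ.erase j, taboo P j i x * survival P j 0 x
        = ∑ x ∈ Finset.univ.erase j, P i x :=
      Finset.sum_congr rfl fun k hk => by
        rw [survival_zero, taboo_apply, if_neg (Finset.ne_of_mem_erase hk), mul_one]
    rw [this, taboo_apply, if_pos rfl]
    linarith
  | succ n ih =>
    rw [survival_succ, pow_succ' P, mul_apply, ← Finset.sum_add_distrib, ← h1 i]
    refine Finset.sum_le_sum fun k _ => ?_
    have hs := survival_nonneg h0 j (n + 1) k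
    have hik := h0 i k
    rw [taboo_apply]
    split_ifs <;> nlinarith [ih k]

/-- The survival probabilities of an irreducible chain are uniformly below one after some time. -/
lemma exists_survival_le {P : Matrix S S ℝ} (hP : P ∈ rowStochastic ℝ S) (hirr : P.IsIrreducible)
    (j : S) : ∃ N > 0, ∃ c < 1, 0 < c ∧ ∀ i, survival P j N i ≤ c := by
  have h0 := (mem_rowStochastic_iff_sum.1 hP).1
  choose k hk0 hk using fun i => (isIrreducible_iff_exists_pow_pos h0).1 hirr i j
  have hlt : ∀ i, survival P j (k i) i < 1 := fun i => by
    obtain ⟨n, hn⟩ := Nat.exists_eq_succ_of_ne_zero (hk0 i).ne'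
    have := survival_add_pow_le_one hP j n i
    have h := hk i
    rw [hn] at h ⊢
    exact lt_of_lt_of_le (lt_add_of_pos_right _ h) this
  have hN : ∀ i, k i ≤ ∑ l, k l := fun i =>
    Finset.single_le_sum (f := k) (fun _ _ => Nat.zero_le _) (Finset.mem_univ i)
  have : Nonempty S := ⟨j⟩
  obtain ⟨i₀, hi₀⟩ := Finite.exists_max fun i => survival P j (∑ l, k l) i
  -- The sum of the `k l` is a common time past every `k i`. The `1 / 2` only keeps the bound
  -- positive, so that its `N`-th root is a positive rate.
  refine ⟨∑ l, k l, (hk0 j).trans_le (hN j), max (1 / 2) (survival P j (∑ l, k l) i₀),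
    max_lt (by norm_num) ((survival_antitone hP j i₀ (hN i₀)).trans_lt (hlt i₀)),
    lt_max_of_lt_left (by norm_num), fun i => (hi₀ i).trans (le_max_right _ _)⟩

/-- Surviving `n + N` steps means surviving `n` steps and then `N` more from wherever the chain is.
-/
lemma survival_add_le {P : Matrix S S ℝ} (hP : P ∈ rowStochastic ℝ S) {j : S} {N : ℕ} {c : ℝ}
    (hc : ∀ i, survival P j N i ≤ c) {n : ℕ} {b : ℝ} (hb : ∀ i, survival P j n i ≤ b)
    (i : S) : survival P j (n + N) i ≤ b * c := by
  have h0 := (mem_rowStochastic_iff_sum.1 hP).1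
  have hc0' : 0 ≤ c := (survival_nonneg h0 j N i).trans (hc i)
  have h : survival P j (n + N) i = ∑ k, (taboo P j ^ n) i k * survival P j N k := by
    rw [survival, pow_add, ← mulVec_mulVec]; rfl
  rw [h]
  calc ∑ k, (taboo P j ^ n) i k * survival P j N k ≤ ∑ k, (taboo P j ^ n) i k * c :=
        Finset.sum_le_sum fun k _ =>
          mul_le_mul_of_nonneg_left (hc k) (taboo_pow_nonneg h0 j n i k)
    _ = survival P j n i * c := by rw [← Finset.sum_mul, survival_eq_sum]
    _ ≤ b * c := mul_le_mul_of_nonneg_right (hb i) hc0'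

/-- The survival probabilities of an irreducible chain decay geometrically. -/
lemma exists_survival_le_geometric {P : Matrix S S ℝ} (hP : P ∈ rowStochastic ℝ S)
    (hirr : P.IsIrreducible) (j : S) :
    ∃ C r : ℝ, 0 ≤ r ∧ r < 1 ∧ ∀ n i, survival P j n i ≤ C * r ^ n := by
  obtain ⟨N, hN, c, hc1, hc0, hc⟩ := exists_survival_le hP hirr j
  set r : ℝ := c ^ ((N : ℝ)⁻¹) with hr
  have hr0 : 0 < r := Real.rpow_pos_of_pos hc0 _
  have hr1 : r < 1 := Real.rpow_lt_one hc0.le hc1 (by positivity)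
  have hrN : r ^ N = c := Real.rpow_inv_natCast_pow hc0.le hN.ne'
  -- The constant `1 / c` covers `n < N`, where only the bound by one is available.
  refine ⟨(r ^ N)⁻¹, r, hr0.le, hr1, fun n => ?_⟩
  induction n using Nat.strong_induction_on with
  | _ n ih =>
    intro i
    rcases lt_or_ge n N with hn | hn
    · refine (survival_le_one hP j n i).trans ?_
      rw [inv_mul_eq_div, one_le_div (by positivity)]
      exact pow_le_pow_of_le_one hr0.le hr1.le hn.le
    · obtain ⟨m, rfl⟩ := Nat.exists_eq_add_of_le' hn
      have := survival_add_le hP hc (ih m (by omega)) i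
      rwa [← hrN, mul_assoc, ← pow_add] at this

lemma summable_mul_survival {P : Matrix S S ℝ} (hP : P ∈ rowStochastic ℝ S)
    (hirr : P.IsIrreducible) (j i : S) : Summable fun n : ℕ => (n : ℝ) * survival P j n i := by
  have h0 := (mem_rowStochastic_iff_sum.1 hP).1
  obtain ⟨C, r, hr0, hr1, h⟩ := exists_survival_le_geometric hP hirr j
  have hs := (summable_pow_mul_geometric_of_norm_lt_one 1
    (by rwa [Real.norm_of_nonneg hr0] : ‖r‖ < 1)).mul_left C
  refine Summable.of_nonneg_of_le
    (fun n => mul_nonneg n.cast_nonneg (survival_nonneg h0 j n i)) (fun n => ?_) hs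
  calc (n : ℝ) * survival P j n i ≤ n * (C * r ^ n) :=
        mul_le_mul_of_nonneg_left (h n i) n.cast_nonneg
    _ = C * ((n : ℝ) ^ 1 * r ^ n) := by ring

lemma summable_survival {P : Matrix S S ℝ} (hP : P ∈ rowStochastic ℝ S)
    (hirr : P.IsIrreducible) (j i : S) : Summable fun n : ℕ => survival P j n i := by
  have h0 := (mem_rowStochastic_iff_sum.1 hP).1
  obtain ⟨C, r, hr0, hr1, h⟩ := exists_survival_le_geometric hP hirr j
  exact Summable.of_nonneg_of_le (fun n => survival_nonneg h0 j n i) (fun n => h n i)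
    ((summable_geometric_of_lt_one hr0 hr1).mul_left C)

/-- The harmonic functions of an irreducible stochastic matrix are constant. -/
lemma eq_of_mulVec_eq_self {P : Matrix S S ℝ} (hP : P ∈ rowStochastic ℝ S)
    (hirr : P.IsIrreducible) {x : S → ℝ} (hx : P *ᵥ x = x) (i j : S) : x i = x j := by
  obtain ⟨h0, h1⟩ := mem_rowStochastic_iff_sum.1 hP
  -- Since `y` vanishes at `j`, dropping column `j` of `P` does not affect it; `y` is then fixed by
  -- every taboo power, and these tend to zero.
  set y : S → ℝ := fun k => x k - x j with hy
  have hQ : taboo P j *ᵥ y = y := by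
    ext l
    have hl := congrFun hx l
    simp only [mulVec, dotProduct] at hl ⊢
    have : ∀ k, taboo P j l k * y k = P l k * x k - P l k * x j := fun k => by
      rw [taboo_apply]
      split_ifs with h
      · simp [h]
      · simp only [hy]; ring
    rw [Finset.sum_congr rfl fun k _ => this k, Finset.sum_sub_distrib, hl, ← Finset.sum_mul, h1,
      one_mul]
  have hQn : ∀ n, taboo P j ^ n *ᵥ y = y := fun n => by
    induction n with
    | zero => simp
    | succ n ih => rw [pow_succ, ← mulVec_mulVec, hQ, ih]
  have hbound : ∀ n, |y i| ≤ survival P j n i * ‖y‖ := fun n => by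
    conv_lhs => rw [← hQn n]
    rw [survival_eq_sum, Finset.sum_mul]
    refine (Finset.abs_sum_le_sum_abs _ _).trans (Finset.sum_le_sum fun k _ => ?_)
    rw [abs_mul, abs_of_nonneg (taboo_pow_nonneg h0 j n i k)]
    exact mul_le_mul_of_nonneg_left (norm_le_pi_norm y k) (taboo_pow_nonneg h0 j n i k)
  have hlim := (summable_survival hP hirr j i).tendsto_atTop_zero.mul_const ‖y‖
  rw [zero_mul] at hlim
  have : |y i| ≤ 0 := ge_of_tendsto' hlim hbound
  exact sub_eq_zero.1 (abs_nonpos_iff.1 this)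

end Taboo

end MarkovFPT

namespace MarkovFPT

/-! ### From the chain to tail sums and first step equations -/

section Chain

lemma lt_passageTime_iff {S Ω : Type*} (X : ℕ → Ω → S) (j : S) (n : ℕ) (ω : Ω) :
    (n : ℕ∞) < passageTime X j ω ↔ ∀ k, 1 ≤ k → k ≤ n → X k ω ≠ j := by
  have h : passageTime X j ω ≤ (n : ℕ∞) ↔ ∃ k ∈ Set.Icc 1 n, X k ω ∈ ({j} : Set S) :=
    hittingAfter_le_iff
  rw [← not_le, h]
  simp

lemma IsMarkovChain.measurableSet_lt_passageTime {S Ω : Type*} [MeasurableSpace Ω] {P : Matrix S S ℝ}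
    {ℙ : S → Measure Ω} {X : ℕ → Ω → S} (hX : IsMarkovChain P ℙ X) (j : S) (n : ℕ) :
    MeasurableSet {ω | (n : ℕ∞) < passageTime X j ω} := by
  simp only [lt_passageTime_iff, Set.ofPred_forall]
  exact MeasurableSet.iInter fun k => MeasurableSet.iInter fun _ => MeasurableSet.iInter fun _ =>
    (hX.measurableSet_eq k j).compl

variable {S Ω : Type*} [Fintype S] [DecidableEq S] [MeasurableSpace Ω]

lemma measure_eq_sum_inter_fiber {α : Type*} [Fintype α] (μ : Measure Ω) (Y : Ω → α)
    (hY : ∀ a, MeasurableSet (Y ⁻¹' {a})) (A : Set Ω) :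
    μ A = ∑ a, μ (Y ⁻¹' {a} ∩ A) := by
  have h := sum_measure_preimage_singleton (μ := μ.restrict A) (f := Y) Finset.univ
    fun a _ => hY a
  simp only [Measure.restrict_apply (hY _)] at h
  rw [h]
  simp

/-- The Markov property for events that depend on the path up to time `n`. -/
lemma IsMarkovChain.measure_inter_step {P : Matrix S S ℝ} {ℙ : S → Measure Ω} {X : ℕ → Ω → S}
    (hX : IsMarkovChain P ℙ X) (i : S) (n : ℕ) (C : (ℕ → S) → Prop)
    (hC : ∀ a b : ℕ → S, (∀ k ≤ n, a k = b k) → (C a ↔ C b)) (t s : S) :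
    ℙ i {ω | C (fun k => X k ω) ∧ X n ω = t ∧ X (n + 1) ω = s} =
      ℙ i {ω | C (fun k => X k ω) ∧ X n ω = t} * ENNReal.ofReal (P t s) := by
  let Y : Ω → Fin (n + 1) → S := fun ω k => X k ω
  have hY : ∀ a, MeasurableSet (Y ⁻¹' {a}) := fun a => by
    have : Y ⁻¹' {a} = ⋂ k : Fin (n + 1), {ω | X k ω = a k} := by
      ext ω; simp [Y, funext_iff]
    rw [this]
    exact MeasurableSet.iInter fun k => hX.measurableSet_eq k (a k)
  rw [measure_eq_sum_inter_fiber (ℙ i) Y hY, measure_eq_sum_inter_fiber (ℙ i) Y hY {ω | _ ∧ _},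
    Finset.sum_mul]
  refine Finset.sum_congr rfl fun a _ => ?_
  -- The value `s` beyond `n` makes the one-step extension of this path end at `s`, as `markov`
  -- requires.
  let b : ℕ → S := fun k => if h : k < n + 1 then a ⟨k, h⟩ else s
  have hbs : b (n + 1) = s := by simp [b]
  have hYb : ∀ ω, Y ω = a ↔ ∀ k ≤ n, X k ω = b k := fun ω => by
    rw [funext_iff]
    constructor
    · intro h k hk
      have := h ⟨k, Nat.lt_succ_of_le hk⟩
      rw [← show b k = a ⟨k, Nat.lt_succ_of_le hk⟩ from dif_pos _] at this
      exact this
    · intro h k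
      have := h k (Nat.le_of_lt_succ k.2)
      rw [show b k = a k from dif_pos k.2] at this
      exact this
  by_cases hb : C b ∧ b n = t
  · have h1 : Y ⁻¹' {a} ∩ {ω | C (fun k => X k ω) ∧ X n ω = t ∧ X (n + 1) ω = s} =
        {ω | ∀ k ≤ n + 1, X k ω = b k} := by
      ext ω
      simp only [Set.mem_inter_iff, Set.mem_preimage, Set.mem_singleton_iff, hYb,
        Set.mem_ofPred_eq]
      constructor
      · rintro ⟨h, -, -, h'⟩ k hk
        rcases Nat.le_succ_iff.1 hk with hk | rfl
        · exact h k hk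
        · rw [h', hbs]
      · intro h
        have h' : ∀ k ≤ n, X k ω = b k := fun k hk => h k (by omega)
        exact ⟨h', (hC _ _ h').2 hb.1, (h' n le_rfl).trans hb.2, (h (n + 1) le_rfl).trans hbs⟩
    have h2 : Y ⁻¹' {a} ∩ {ω | C (fun k => X k ω) ∧ X n ω = t} =
        {ω | ∀ k ≤ n, X k ω = b k} := by
      ext ω
      simp only [Set.mem_inter_iff, Set.mem_preimage, Set.mem_singleton_iff, hYb,
        Set.mem_ofPred_eq]
      exact ⟨fun h => h.1, fun h => ⟨h, (hC _ _ h).2 hb.1, (h n le_rfl).trans hb.2⟩⟩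
    rw [h1, h2, hX.markov i n b, hb.2, hbs]
  · have h2 : Y ⁻¹' {a} ∩ {ω | C (fun k => X k ω) ∧ X n ω = t} = ∅ := by
      ext ω
      simp only [Set.mem_inter_iff, Set.mem_preimage, Set.mem_singleton_iff, hYb,
        Set.mem_ofPred_eq, Set.mem_empty_iff_false, iff_false]
      rintro ⟨h, hc, ht⟩
      exact hb ⟨(hC _ _ h).1 hc, (h n le_rfl).symm.trans ht⟩
    have h1 : Y ⁻¹' {a} ∩ {ω | C (fun k => X k ω) ∧ X n ω = t ∧ X (n + 1) ω = s} = ∅ :=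
      Set.subset_eq_empty (by rintro ω ⟨hω, hc, ht, -⟩; exact ⟨hω, hc, ht⟩) h2
    rw [h1, h2, measure_empty, zero_mul]

lemma IsMarkovChain.measure_avoid {P : Matrix S S ℝ} (hP : ∀ i k, 0 ≤ P i k)
    {ℙ : S → Measure Ω} {X : ℕ → Ω → S} (hX : IsMarkovChain P ℙ X) (i j : S) (n : ℕ) (s : S) :
    ℙ i {ω | (∀ k, 1 ≤ k → k ≤ n → X k ω ≠ j) ∧ X n ω = s} =
      ENNReal.ofReal ((taboo P j ^ n) i s) := by
  have := hX.isProbabilityMeasure i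
  induction n generalizing s with
  | zero =>
    have h : {ω | (∀ k, 1 ≤ k → k ≤ 0 → X k ω ≠ j) ∧ X 0 ω = s} =ᵐ[ℙ i] {_ω | i = s} := by
      rw [Filter.eventuallyEq_set]
      filter_upwards [hX.start i] with ω hω
      simp only [hω]
      exact ⟨fun h => h.2, fun h => ⟨fun k h1 h2 => by omega, h⟩⟩
    rw [measure_congr h, pow_zero, Matrix.one_apply]
    by_cases his : i = s
    · subst his; simp
    · simp [his]
  | succ n ih =>
    by_cases hs : s = j
    · have h1 : {ω | (∀ k, 1 ≤ k → k ≤ n + 1 → X k ω ≠ j) ∧ X (n + 1) ω = s} = ∅ := by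
        ext ω
        simp only [Set.mem_ofPred_eq, Set.mem_empty_iff_false, iff_false]
        rintro ⟨h, h'⟩
        exact h (n + 1) (by omega) le_rfl (h'.trans hs)
      rw [h1, pow_succ, mul_apply]
      simp [taboo_apply, hs]
    · rw [measure_eq_sum_inter_fiber (ℙ i) (X n) (hX.measurableSet_eq n), pow_succ, mul_apply,
        ENNReal.ofReal_sum_of_nonneg fun t _ =>
          mul_nonneg (taboo_pow_nonneg hP j n i t) (taboo_nonneg hP j t s)]
      refine Finset.sum_congr rfl fun t _ => ?_
      rw [ENNReal.ofReal_mul (taboo_pow_nonneg hP j n i t), ← ih t, taboo_apply, if_neg hs,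
        ← hX.measure_inter_step i n (fun a => ∀ k, 1 ≤ k → k ≤ n → a k ≠ j)
          (fun a b hab => forall_congr' fun k => imp_congr_right fun _ =>
            forall_congr' fun hk => by rw [hab k hk]) t s]
      congr 1
      ext ω
      simp only [Set.mem_inter_iff, Set.mem_preimage, Set.mem_singleton_iff, Set.mem_ofPred_eq]
      constructor
      · rintro ⟨ht, h, h'⟩
        exact ⟨fun k h1 h2 => h k h1 (by omega), ht, h'⟩
      · rintro ⟨h, ht, h'⟩
        refine ⟨ht, fun k h1 h2 => ?_, h'⟩
        rcases Nat.le_succ_iff.1 h2 with h2 | rfl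
        · exact h k h1 h2
        · rw [h']; exact hs

lemma IsMarkovChain.measure_lt_passageTime {P : Matrix S S ℝ} (hP : ∀ i k, 0 ≤ P i k)
    {ℙ : S → Measure Ω} {X : ℕ → Ω → S} (hX : IsMarkovChain P ℙ X) (i j : S) (n : ℕ) :
    ℙ i {ω | (n : ℕ∞) < passageTime X j ω} = ENNReal.ofReal (survival P j n i) := by
  simp only [lt_passageTime_iff]
  rw [measure_eq_sum_inter_fiber (ℙ i) (X n) (hX.measurableSet_eq n), survival_eq_sum,
    ENNReal.ofReal_sum_of_nonneg fun t _ => taboo_pow_nonneg hP j n i t]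
  refine Finset.sum_congr rfl fun t _ => ?_
  rw [← hX.measure_avoid hP i j n t]
  congr 1
  ext ω
  exact and_comm

/-- Layer-cake formula: `c n = (n+1)^k - n^k` are the increments of the power. That they never
vanish makes the sum infinite at `T = ⊤`. -/
lemma enat_pow_eq_tsum {k : ℕ} (hk : k ≠ 0) {c : ℕ → ℕ} (hc : ∀ n, c n ≠ 0)
    (hsum : ∀ m, ∑ n ∈ Finset.range m, c n = m ^ k) (T : ℕ∞) :
    (T : ℝ≥0∞) ^ k = ∑' n : ℕ, if (n : ℕ∞) < T then (c n : ℝ≥0∞) else 0 := by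
  induction T using ENat.recTopCoe with
  | top =>
    rw [ENat.toENNReal_top, ENNReal.top_pow hk, eq_comm, eq_top_iff,
      ← ENNReal.tsum_const_eq_top_of_ne_zero (α := ℕ) one_ne_zero]
    refine ENNReal.tsum_le_tsum fun n => ?_
    rw [if_pos (ENat.natCast_lt_top n)]
    exact_mod_cast Nat.one_le_iff_ne_zero.2 (hc n)
  | coe m =>
    rw [tsum_eq_sum (s := Finset.range m)]
    · rw [Finset.sum_congr rfl fun n hn =>
        if_pos (Nat.cast_lt.2 (Finset.mem_range.1 hn)), ENat.toENNReal_coe]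
      exact_mod_cast (hsum m).symm
    · intro n hn
      rw [if_neg]
      rw [Nat.cast_lt]
      simpa using hn

lemma IsMarkovChain.passageMoment_eq_tsum {P : Matrix S S ℝ} (hP : ∀ i k, 0 ≤ P i k)
    {ℙ : S → Measure Ω} {X : ℕ → Ω → S} (hX : IsMarkovChain P ℙ X) {k : ℕ} (hk : k ≠ 0)
    {c : ℕ → ℕ} (hc : ∀ n, c n ≠ 0) (hsum : ∀ m, ∑ n ∈ Finset.range m, c n = m ^ k) (i j : S) :
    passageMoment ℙ X k i j = ∑' n, ENNReal.ofReal (c n * survival P j n i) := by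
  have h : ∀ ω, (passageTime X j ω : ℝ≥0∞) ^ k = ∑' n : ℕ,
      Set.indicator {ω | (n : ℕ∞) < passageTime X j ω} (fun _ => (c n : ℝ≥0∞)) ω := fun ω => by
    rw [enat_pow_eq_tsum hk hc hsum]
    simp [Set.indicator_apply]
  simp only [passageMoment, h]
  rw [lintegral_tsum fun n =>
    (measurable_const.indicator (hX.measurableSet_lt_passageTime j n)).aemeasurable]
  refine tsum_congr fun n => ?_
  rw [lintegral_indicator_const (hX.measurableSet_lt_passageTime j n),
    hX.measure_lt_passageTime hP, ENNReal.ofReal_mul (Nat.cast_nonneg _), ENNReal.ofReal_natCast]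

variable {P : Matrix S S ℝ} {ℙ : S → Measure Ω} {X : ℕ → Ω → S}

lemma IsMarkovChain.passageMoment_one_eq_ofReal (hP : P ∈ rowStochastic ℝ S)
    (hirr : P.IsIrreducible) (hX : IsMarkovChain P ℙ X) (i j : S) :
    passageMoment ℙ X 1 i j = ENNReal.ofReal (∑' n, survival P j n i) := by
  have h0 := (mem_rowStochastic_iff_sum.1 hP).1
  rw [hX.passageMoment_eq_tsum h0 one_ne_zero (c := fun _ => 1) (by simp) (by simp),
    ENNReal.ofReal_tsum_of_nonneg (fun n => survival_nonneg h0 j n i)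
      (summable_survival hP hirr j i)]
  simp

lemma IsMarkovChain.passageMoment_two_eq_ofReal (hP : P ∈ rowStochastic ℝ S)
    (hirr : P.IsIrreducible) (hX : IsMarkovChain P ℙ X) (i j : S) :
    passageMoment ℙ X 2 i j =
      ENNReal.ofReal (2 * (∑' n : ℕ, n * survival P j n i) + ∑' n, survival P j n i) := by
  have h0 := (mem_rowStochastic_iff_sum.1 hP).1
  have hs := summable_mul_survival hP hirr j i
  have hs' := summable_survival hP hirr j i
  -- `2 * n + 1 = (n+1)^2 - n^2`.
  rw [hX.passageMoment_eq_tsum h0 two_ne_zero (c := fun n => 2 * n + 1) (by simp)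
    (fun m => by
      induction m with
      | zero => simp
      | succ m ih => rw [Finset.sum_range_succ, ih]; ring),
    ← tsum_mul_left, ← (hs.mul_left 2).tsum_add hs',
    ENNReal.ofReal_tsum_of_nonneg (fun n => by have := survival_nonneg h0 j n i; positivity)
      ((hs.mul_left 2).add hs')]
  refine tsum_congr fun n => ?_
  push_cast
  ring_nf

lemma IsMarkovChain.momentMatrix_one_apply (hP : P ∈ rowStochastic ℝ S)
    (hirr : P.IsIrreducible) (hX : IsMarkovChain P ℙ X) (i j : S) :
    momentMatrix ℙ X 1 i j = ∑' n, survival P j n i := by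
  have h0 := (mem_rowStochastic_iff_sum.1 hP).1
  rw [momentMatrix, of_apply, hX.passageMoment_one_eq_ofReal hP hirr, ENNReal.toReal_ofReal]
  exact tsum_nonneg fun n => survival_nonneg h0 j n i

lemma IsMarkovChain.momentMatrix_two_apply (hP : P ∈ rowStochastic ℝ S)
    (hirr : P.IsIrreducible) (hX : IsMarkovChain P ℙ X) (i j : S) :
    momentMatrix ℙ X 2 i j =
      2 * (∑' n : ℕ, n * survival P j n i) + ∑' n, survival P j n i := by
  have h0 := (mem_rowStochastic_iff_sum.1 hP).1
  rw [momentMatrix, of_apply, hX.passageMoment_two_eq_ofReal hP hirr, ENNReal.toReal_ofReal]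
  exact add_nonneg (mul_nonneg two_pos.le (tsum_nonneg fun n =>
    mul_nonneg n.cast_nonneg (survival_nonneg h0 j n i)))
    (tsum_nonneg fun n => survival_nonneg h0 j n i)

lemma tsum_survival_eq (hP : P ∈ rowStochastic ℝ S) (hirr : P.IsIrreducible) (i j : S) :
    ∑' n, survival P j n i = 1 + ∑ k, taboo P j i k * ∑' n, survival P j n k := by
  rw [(summable_survival hP hirr j i).tsum_eq_zero_add, survival_zero]
  simp only [survival_succ, ← tsum_mul_left]
  rw [Summable.tsum_finsetSum fun k _ => (summable_survival hP hirr j k).mul_left _]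

lemma tsum_mul_survival_eq (hP : P ∈ rowStochastic ℝ S) (hirr : P.IsIrreducible) (i j : S) :
    ∑' n : ℕ, n * survival P j n i = ∑ k, taboo P j i k *
      (∑' n : ℕ, n * survival P j n k + ∑' n, survival P j n k) := by
  rw [(summable_mul_survival hP hirr j i).tsum_eq_zero_add, Nat.cast_zero, zero_mul, zero_add]
  have hs := fun k => (summable_mul_survival hP hirr j k).add (summable_survival hP hirr j k)
  have : ∀ k, ∑' n : ℕ, n * survival P j n k + ∑' n, survival P j n k =
      ∑' n : ℕ, (n * survival P j n k + survival P j n k) := fun k =>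
    ((summable_mul_survival hP hirr j k).tsum_add (summable_survival hP hirr j k)).symm
  simp only [this, ← tsum_mul_left]
  rw [← Summable.tsum_finsetSum fun k _ => (hs k).mul_left _]
  refine tsum_congr fun n => ?_
  rw [survival_succ, Finset.mul_sum]
  refine Finset.sum_congr rfl fun k _ => ?_
  push_cast
  ring

/-- Within column `j`, deleting transitions into `j` amounts to deleting the diagonal entry of `A`.
This turns the scalar recursions into matrix equations. -/
lemma sum_taboo_mul (P A : Matrix S S ℝ) (i j : S) :
    ∑ k, taboo P j i k * A k j = (P * (A - diagPart A)) i j := by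
  rw [mul_apply]
  refine Finset.sum_congr rfl fun k _ => ?_
  rw [taboo_apply, Matrix.sub_apply, diagPart, diagonal_apply]
  split_ifs with h
  · subst h; simp
  · simp

/-- The first step equation for the mean first passage times. -/
lemma IsMarkovChain.momentMatrix_one_eq (hP : P ∈ rowStochastic ℝ S)
    (hirr : P.IsIrreducible) (hX : IsMarkovChain P ℙ X) :
    momentMatrix ℙ X 1 = Matrix.of (fun _ _ => 1) +
      P * (momentMatrix ℙ X 1 - diagPart (momentMatrix ℙ X 1)) := by
  ext i j
  rw [Matrix.add_apply, ← sum_taboo_mul, of_apply]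
  simp only [hX.momentMatrix_one_apply hP hirr]
  exact tsum_survival_eq hP hirr i j

/-- The first step equation for the second moments of the first passage times. -/
lemma IsMarkovChain.momentMatrix_two_eq (hP : P ∈ rowStochastic ℝ S)
    (hirr : P.IsIrreducible) (hX : IsMarkovChain P ℙ X) :
    momentMatrix ℙ X 2 = Matrix.of (fun _ _ => 1) +
      2 • (P * (momentMatrix ℙ X 1 - diagPart (momentMatrix ℙ X 1))) +
      P * (momentMatrix ℙ X 2 - diagPart (momentMatrix ℙ X 2)) := by
  ext i j
  rw [Matrix.add_apply, Matrix.add_apply, Matrix.smul_apply, ← sum_taboo_mul, ← sum_taboo_mul, of_apply]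
  simp only [hX.momentMatrix_one_apply hP hirr, hX.momentMatrix_two_apply hP hirr]
  rw [tsum_survival_eq hP hirr i j, tsum_mul_survival_eq hP hirr i j]
  simp only [mul_add, Finset.sum_add_distrib, Finset.mul_sum, nsmul_eq_mul]
  simp only [mul_left_comm _ (2 : ℝ), ← Finset.mul_sum]
  push_cast
  ring

end Chain

end MarkovFPT

namespace MarkovFPT

/-! ### Solving `(I-P)Y = R - P Y_d` with a g-inverse -/

section GInverse

variable {S : Type*}

lemma diagPart_sub [DecidableEq S] (A B : Matrix S S ℝ) :
    diagPart (A - B) = diagPart A - diagPart B := by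
  simp [diagPart, diagonal_sub, Pi.sub_def]

lemma diagPart_nsmul [DecidableEq S] (n : ℕ) (A : Matrix S S ℝ) :
    diagPart (n • A) = n • diagPart A := by
  rw [diagPart, diagPart, ← diagonal_smul, diag_smul]

variable [Fintype S] [DecidableEq S] {P G : Matrix S S ℝ}

lemma mul_diagPart_apply (A B : Matrix S S ℝ) (i j : S) :
    (A * diagPart B) i j = A i j * B j j := by
  simp [diagPart, mul_diagonal]

/-- The solutions of `(1 - P) * Y = C` agree with `G * C` up to constant columns. -/
lemma IsGInverse.exists_eq_add_const (hG : IsGInverse (1 - P) G) (hP : P ∈ rowStochastic ℝ S)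
    (hirr : P.IsIrreducible) {Y C : Matrix S S ℝ} (hY : (1 - P) * Y = C) :
    ∃ b : S → ℝ, ∀ i j, Y i j = (G * C) i j + b j := by
  have hK : (1 - P) * (Y - G * C) = 0 := by
    rw [mul_sub, ← hY, ← mul_assoc, ← mul_assoc, show (1 - P) * G * (1 - P) = 1 - P from hG,
      sub_self]
  have hconst : ∀ i k j, (Y - G * C) i j = (Y - G * C) k j := fun i k j => by
    refine eq_of_mulVec_eq_self hP hirr (x := fun l => (Y - G * C) l j) ?_ i k
    ext l
    have h := congrFun (congrFun hK l) j
    rw [sub_mul, one_mul, Matrix.sub_apply, Matrix.zero_apply, sub_eq_zero] at h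
    exact h.symm
  refine ⟨fun j => (Y - G * C) j j, fun i j => ?_⟩
  have h := hconst i j j
  simp only [Matrix.sub_apply] at h ⊢
  linarith

/-- The solution of `(1 - P) * Y = R - P * Y_d` in terms of its diagonal part. -/
lemma IsGInverse.eq_of_one_sub_mul_eq (hG : IsGInverse (1 - P) G) (hP : P ∈ rowStochastic ℝ S)
    (hirr : P.IsIrreducible) {Y R : Matrix S S ℝ} (hY : (1 - P) * Y = R - P * diagPart Y) :
    Y = (G * R - Matrix.of (fun _ _ => 1) * diagPart (G * R))
      + (1 - G + Matrix.of (fun _ _ => 1) * diagPart G) * diagPart Y := by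
  obtain ⟨b, hb⟩ := hG.exists_eq_add_const hP hirr hY
  -- Taking `Y = 1` shows that `G * P` is `G - 1` up to constant columns.
  obtain ⟨β, hβ⟩ := hG.exists_eq_add_const hP hirr (mul_one (1 - P))
  ext i j
  have key : ∀ k, Y k j = (G * R) k j - (G k j - (1 : Matrix S S ℝ) k j + β j) * Y j j + b j :=
    fun k => by
      have h := hβ k j
      rw [mul_sub, mul_one, Matrix.sub_apply] at h
      rw [hb k j, mul_sub, ← mul_assoc, Matrix.sub_apply, mul_diagPart_apply, h]
      ring
  have hi := key i
  -- The row `j` determines `b j - β j * Y j j`, the only combination of the unknown constants that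
  -- occurs.
  have hj := key j
  rw [Matrix.one_apply_eq] at hj
  simp only [Matrix.add_apply, Matrix.sub_apply, mul_diagPart_apply, of_apply, one_mul]
  linarith

end GInverse

end MarkovFPT

/-! ### The moment formulas -/

theorem theorem7p8 {S Ω : Type*} [Fintype S] [DecidableEq S] [MeasurableSpace Ω]
    (P : Matrix S S ℝ) (hP : P ∈ Matrix.rowStochastic ℝ S) (hirr : P.IsIrreducible)
    (ℙ : S → MeasureTheory.Measure Ω) (X : ℕ → Ω → S) (hX : MarkovFPT.IsMarkovChain P ℙ X)
    (π : S → ℝ) (hπ : π ᵥ* P = π) (hπ1 : ∑ i, π i = 1)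
    (G : Matrix S S ℝ) (hG : MarkovFPT.IsGInverse (1 - P) G)
    (M M2 E PI D : Matrix S S ℝ)
    (hM : M = MarkovFPT.momentMatrix ℙ X 1)
    (hM2 : M2 = MarkovFPT.momentMatrix ℙ X 2)
    (hE : E = Matrix.of fun _ _ => 1)
    (hPI : PI = Matrix.of fun _ j => π j)
    (hD : D = Matrix.diagonal fun i => 1 / π i) :
    (∀ i j, MarkovFPT.passageMoment ℙ X 1 i j ≠ ∞ ∧ MarkovFPT.passageMoment ℙ X 2 i j ≠ ∞) ∧
    (∀ i, 0 < π i) ∧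
    MarkovFPT.diagPart M = D ∧
    M2 = 2 • (G * M - E * MarkovFPT.diagPart (G * M))
      + (1 - G + E * MarkovFPT.diagPart G) * (MarkovFPT.diagPart M2 + D) - M ∧
    M2 = 2 • (G * M - E * MarkovFPT.diagPart (G * M))
      + 2 • ((1 - G + E * MarkovFPT.diagPart G) * D * MarkovFPT.diagPart (PI * M)) - M ∧
    ((∃ g : ℝ, G *ᵥ (fun _ => 1) = fun _ => g) →
      M2 = 2 • (G * M - E * MarkovFPT.diagPart (G * M))
        + M * D⁻¹ * MarkovFPT.diagPart M2) := by
  have hMeq := hX.momentMatrix_one_eq hP hirr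
  have hM2eq := hX.momentMatrix_two_eq hP hirr
  have hMnonneg : ∀ i j, 0 ≤ M i j := fun i j => by rw [hM]; exact ENNReal.toReal_nonneg
  rw [← hM, ← hE] at hMeq
  rw [← hM, ← hM2, ← hE] at hM2eq
  have h1 : (1 - P) * M = E - P * MarkovFPT.diagPart M := by
    rw [sub_mul, one_mul]
    nth_rewrite 1 [hMeq]
    rw [mul_sub]
    abel
  have h2 : (1 - P) * M2 = (2 • M - E) - P * MarkovFPT.diagPart M2 := by
    have h : P * (M - MarkovFPT.diagPart M) = M - E := eq_sub_of_add_eq' hMeq.symm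
    rw [h] at hM2eq
    rw [sub_mul, one_mul]
    nth_rewrite 1 [hM2eq]
    rw [mul_sub, smul_sub, two_nsmul E]
    abel
  have hπE : π ᵥ* E = 1 := by
    ext j
    simp [hE, vecMul, dotProduct, hπ1]
  have hπP : π ᵥ* (1 - P) = 0 := by rw [vecMul_sub, vecMul_one, hπ, sub_self]
  -- Multiplying by `π` on the left kills `(1 - P) * Y` and turns `P * Y_d` into `π Y_d`.
  have hdiag : ∀ R Y : Matrix S S ℝ, (1 - P) * Y = R - P * MarkovFPT.diagPart Y →
      ∀ j, π j * Y j j = (π ᵥ* R) j := fun R Y h j => by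
    have h' := congrFun (congrArg (π ᵥ* ·) h) j
    simp only [← vecMul_vecMul, hπP, zero_vecMul, vecMul_sub, hπ] at h'
    simp only [MarkovFPT.diagPart, Pi.sub_apply, Pi.zero_apply, vecMul_diagonal, diag_apply] at h'
    linarith
  have hπM : ∀ j, π j * M j j = 1 := fun j => by rw [hdiag _ _ h1, hπE, Pi.one_apply]
  -- Positivity of `π` comes from `π j * M j j = 1` and `M j j ≥ 0`.
  have hπpos : ∀ j, 0 < π j := fun j => pos_of_mul_pos_left (by rw [hπM j]; exact one_pos)
    (hMnonneg j j)
  have hMd : MarkovFPT.diagPart M = D := by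
    rw [hD, MarkovFPT.diagPart]
    congr 1
    ext j
    rw [diag_apply, eq_div_iff (hπpos j).ne', mul_comm, hπM]
  have hM2d : MarkovFPT.diagPart M2 + D = 2 • (D * MarkovFPT.diagPart (PI * M)) := by
    have h : ∀ j, M2 j j + 1 / π j = 2 * (1 / π j * (PI * M) j j) := fun j => by
      have hj := hdiag _ _ h2 j
      rw [vecMul_sub, hπE, two_nsmul, vecMul_add] at hj
      have hPIM : (PI * M) j j = (π ᵥ* M) j := by rw [hPI]; rfl
      rw [hPIM]
      simp only [Pi.sub_apply, Pi.add_apply, Pi.one_apply] at hj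
      have := (hπpos j).ne'
      field_simp
      linarith
    rw [hD, MarkovFPT.diagPart, MarkovFPT.diagPart, diagonal_mul_diagonal, diagonal_add,
      ← diagonal_smul]
    congr 1
    ext j
    simpa using h j
  have e1 := hG.eq_of_one_sub_mul_eq hP hirr h1
  have e2 := hG.eq_of_one_sub_mul_eq hP hirr h2
  rw [← hE] at e1 e2
  rw [hMd] at e1
  rw [mul_sub, mul_smul_comm, MarkovFPT.diagPart_sub, MarkovFPT.diagPart_nsmul, mul_sub,
    mul_smul_comm] at e2
  have f1 : M2 = 2 • (G * M - E * MarkovFPT.diagPart (G * M))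
      + (1 - G + E * MarkovFPT.diagPart G) * (MarkovFPT.diagPart M2 + D) - M := by
    nth_rewrite 1 [e2]
    -- The fifth `M` is the isolated `-M`; expanding it supplies the `G * E` terms and the summand
    -- with `D`.
    nth_rewrite 5 [e1]
    rw [mul_add, smul_sub]
    abel
  refine ⟨fun i j => ?_, hπpos, hMd, f1, ?_, ?_⟩
  · rw [hX.passageMoment_one_eq_ofReal hP hirr, hX.passageMoment_two_eq_ofReal hP hirr]
    exact ⟨ENNReal.ofReal_ne_top, ENNReal.ofReal_ne_top⟩
  · rwa [hM2d, mul_smul_comm, ← mul_assoc] at f1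
  · rintro ⟨g, hg⟩
    -- Constant row sums of `G` give `G * E = g E`, so `M = (1 - G + E G_d) D`; then `M D⁻¹` is the
    -- bracket and its `D` term cancels `-M`.
    have hGE : G * E - E * MarkovFPT.diagPart (G * E) = 0 := by
      have h : ∀ i j, (G * E) i j = g := fun i j => by
        rw [hE]
        exact congrFun hg i
      ext i j
      rw [Matrix.sub_apply, MarkovFPT.mul_diagPart_apply, h, h, hE, of_apply, one_mul, sub_self,
        Matrix.zero_apply]
    rw [hGE, zero_add] at e1
    have hDunit : IsUnit D.det := by
      rw [hD, det_diagonal]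
      exact (Finset.prod_ne_zero_iff.2 fun j _ => (one_div_pos.2 (hπpos j)).ne').isUnit
    rw [mul_add, ← e1] at f1
    have hMD : M * D⁻¹ = 1 - G + E * MarkovFPT.diagPart G := by
      rw [e1, mul_nonsing_inv_cancel_right _ _ hDunit]
    rw [hMD]
    rwa [← add_assoc, add_sub_cancel_right] at f1
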